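/- Let $n\in\mathbb{N}$ and let $A$ be a real $n\times n$ matrix with $A\mathbb{Z}^n\subset\mathbb{Z}^n$, all of whose (complex) eigenvalues $\lambda$ satisfy $|\lambda|>1$; write $A^*$ for its transpose. On $L^2(\mathbb{R}^n)$ (complex-valued functions, Lebesgue measure) define the unitary operators $$T_kf(x)=f(x-k)\quad(k\in\mathbb{Z}^n),\qquad D_Af(x)=|\det A|^{1/2}f(Ax),$$ and let $\widehat f$ be the $L^2$-Fourier transform normalized by $\widehat f(\xi)=\int_{\mathbb{R}^n}f(x)e^{-i\langle x,\xi\rangle}\,dx$. Let $V_0$ be a closed subspace of $L^2(\mathbb{R}^n)$ which is shift invariant ($T_kV_0=V_0$ for all $k\in\mathbb{Z}^n$) and refinable ($V_0\subset D_AV_0$). Let $\Phi\subset V_0$ be a normalized tight frame generator for $V_0$, i.e. $$\sum_{\varphi\in\Phi}\sum_{k\in\mathbb{Z}^n}|\langle f,T_k\varphi\rangle|^2=\|f\|^2\qquad\text{for all } f\in V_0 .$$ Put $V_j=D_A^jV_0$ for $j\in\mathbb{Z}$. Then the following are equivalent: 1. $\overline{\bigcup_{j\in\mathbb{Z}}V_j}=L^2(\mathbb{R}^n)$;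 2. $\displaystyle\lim_{j\to\infty}\sum_{\varphi\in\Phi}\bigl|\widehat\varphi\bigl((A^*)^{-j}\xi\bigr)\bigr|^2=1$ for a.e. $\xi\in\mathbb{R}^n$. -/

import Mathlib

open MeasureTheory Filter
open scoped ENNReal FourierTransform Topology

namespace RefinableNTF

noncomputable section

/-- The Euclidean space `ℝⁿ`. -/
abbrev Rn (n : ℕ) : Type := EuclideanSpace ℝ (Fin n)

/-- The complex Hilbert space `L²(ℝⁿ)` with respect to Lebesgue measure. -/
abbrev L2 (n : ℕ) : Type := Lp (α := Rn n) ℂ 2 volume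

/-- The action `x ↦ M x` of a real matrix on `ℝⁿ`. -/
def act {n : ℕ} (M : Matrix (Fin n) (Fin n) ℝ) : Rn n →ₗ[ℝ] Rn n := Matrix.toEuclideanLin M

/-- The lattice point of `ℝⁿ` given by an integer vector. -/
def latticePt {n : ℕ} (k : Fin n → ℤ) : Rn n := WithLp.toLp 2 (fun i => (k i : ℝ))

/-- A lattice-preserving dilation matrix: all complex eigenvalues have modulus greater than one and
`A ℤⁿ ⊆ ℤⁿ`. -/
structure IsDilationMatrix {n : ℕ} (A : Matrix (Fin n) (Fin n) ℝ) : Prop where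
  one_lt_norm_eigenvalue : ∀ z : ℂ,
    Module.End.HasEigenvalue (Matrix.toLin' (A.map ((↑) : ℝ → ℂ))) z → 1 < ‖z‖
  maps_lattice : ∀ k : Fin n → ℤ, ∃ l : Fin n → ℤ, act A (latticePt k) = latticePt l

theorem IsDilationMatrix.det_ne_zero {n : ℕ} {A : Matrix (Fin n) (Fin n) ℝ}
    (hA : IsDilationMatrix A) : A.det ≠ 0 := by
  intro h0
  have h1 : (A.map ((↑) : ℝ → ℂ)).det = 0 := by
    have := (Complex.ofRealHom.map_det A)
    rw [h0] at this
    exact this.symm.trans (map_zero _)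
  obtain ⟨v, hv, hv0⟩ := Matrix.exists_mulVec_eq_zero_iff.mpr h1
  have h2 := hA.one_lt_norm_eigenvalue 0
    (Module.End.hasEigenvalue_of_hasEigenvector (x := v) ⟨by
      rw [Module.End.mem_eigenspace_iff]; simpa using hv0, hv⟩)
  simp at h2
  linarith

/-- The translation operator `(T_k f)(x) = f (x - k)` on `L²(ℝⁿ)`. -/
def translation {n : ℕ} (k : Fin n → ℤ) : L2 n →ₗᵢ[ℂ] L2 n :=
  Lp.compMeasurePreservingₗᵢ ℂ (fun x : Rn n => x - latticePt k)
    (measurePreserving_sub_right volume (latticePt k))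

theorem map_act_volume {n : ℕ} {A : Matrix (Fin n) (Fin n) ℝ} (hA : A.det ≠ 0) :
    Measure.map (act A) (volume : Measure (Rn n)) = ENNReal.ofReal |A.det|⁻¹ • volume := by
  have hd : LinearMap.det (act A) = A.det := by
    simp [act, Matrix.toEuclideanLin, Matrix.toLpLin_eq_toLin]
  rw [Measure.map_linearMap_addHaar_eq_smul_addHaar volume (by rwa [hd]), hd, abs_inv]

theorem measurable_act {n : ℕ} (A : Matrix (Fin n) (Fin n) ℝ) : Measurable (act A) :=
  (LinearMap.continuous_of_finiteDimensional (act A)).measurable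

theorem quasiMeasurePreserving_act {n : ℕ} {A : Matrix (Fin n) (Fin n) ℝ} (hA : A.det ≠ 0) :
    Measure.QuasiMeasurePreserving (act A) (volume : Measure (Rn n)) volume :=
  ⟨measurable_act A, by
    rw [map_act_volume hA]; exact Measure.smul_absolutelyContinuous⟩

theorem eLpNorm_dilation {n : ℕ} {A : Matrix (Fin n) (Fin n) ℝ} (hA : A.det ≠ 0) (f : L2 n) :
    eLpNorm (fun x : Rn n => ((Real.sqrt |A.det| : ℝ) : ℂ) • f (act A x)) 2 volume
      = eLpNorm f 2 volume := by
  have hpos : 0 < |A.det| := abs_pos.mpr hA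
  have h1 : eLpNorm (fun x : Rn n => f (act A x)) 2 volume
      = ENNReal.ofReal |A.det|⁻¹ ^ (1 / (2 : ℝ≥0∞)).toReal * eLpNorm f 2 volume := by
    have hm : AEStronglyMeasurable f (Measure.map (act A) (volume : Measure (Rn n))) :=
      (Lp.stronglyMeasurable f).aestronglyMeasurable
    rw [← smul_eq_mul, ← eLpNorm_smul_measure_of_ne_top (by simp), ← map_act_volume hA,
      eLpNorm_map_measure hm (measurable_act A).aemeasurable]
    rfl
  have h2 := eLpNorm_const_smul ((Real.sqrt |A.det| : ℝ) : ℂ)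
    (fun x : Rn n => f (act A x)) 2 volume
  refine h2.trans ?_
  rw [h1, ← mul_assoc]
  have h3 : ‖((Real.sqrt |A.det| : ℝ) : ℂ)‖ₑ
      * ENNReal.ofReal |A.det|⁻¹ ^ (1 / (2 : ℝ≥0∞)).toReal = 1 := by
    rw [← ofReal_norm, Complex.norm_real, Real.norm_of_nonneg (Real.sqrt_nonneg _),
      ENNReal.ofReal_rpow_of_pos (inv_pos.mpr hpos), ← ENNReal.ofReal_mul (Real.sqrt_nonneg _)]
    have : (1 / (2 : ℝ≥0∞)).toReal = 1 / 2 := by simp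
    rw [this, ← Real.sqrt_eq_rpow, ← Real.sqrt_mul hpos.le, mul_inv_cancel₀ hpos.ne']
    simp
  rw [h3, one_mul]

theorem memLp_dilation {n : ℕ} {A : Matrix (Fin n) (Fin n) ℝ} (hA : A.det ≠ 0) (f : L2 n) :
    MemLp (fun x : Rn n => ((Real.sqrt |A.det| : ℝ) : ℂ) • f (act A x)) 2 volume := by
  refine ⟨?_, ?_⟩
  · have h : AEStronglyMeasurable (fun x : Rn n => f (act A x)) volume :=
      (Lp.aestronglyMeasurable f).comp_quasiMeasurePreserving (quasiMeasurePreserving_act hA)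
    exact h.const_smul ((Real.sqrt |A.det| : ℝ) : ℂ)
  · rw [eLpNorm_dilation hA]; exact Lp.eLpNorm_lt_top f

/-- The dilation operator `(D_A f)(x) = |det A|^{1/2} f (A x)` as a linear isometry of `L²(ℝⁿ)`. -/
def dilationₗᵢ {n : ℕ} (A : Matrix (Fin n) (Fin n) ℝ) (hA : A.det ≠ 0) : L2 n →ₗᵢ[ℂ] L2 n where
  toFun f := (memLp_dilation hA f).toLp _
  map_add' f g := by
    apply Lp.ext
    filter_upwards [(memLp_dilation hA (f + g)).coeFn_toLp, (memLp_dilation hA f).coeFn_toLp,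
      (memLp_dilation hA g).coeFn_toLp,
      Lp.coeFn_add ((memLp_dilation hA f).toLp _) ((memLp_dilation hA g).toLp _),
      (quasiMeasurePreserving_act hA).ae (Lp.coeFn_add f g)] with x h1 h2 h3 h4 h5
    rw [h1, h4, Pi.add_apply, h2, h3, h5, Pi.add_apply, smul_add]
  map_smul' c f := by
    apply Lp.ext
    filter_upwards [(memLp_dilation hA (c • f)).coeFn_toLp, (memLp_dilation hA f).coeFn_toLp,
      Lp.coeFn_smul c ((memLp_dilation hA f).toLp _),
      (quasiMeasurePreserving_act hA).ae (Lp.coeFn_smul c f)] with x h1 h2 h4 h5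
    rw [h1, RingHom.id_apply, h4, Pi.smul_apply, h2, h5, Pi.smul_apply, smul_comm]
  norm_map' f := by
    change ‖(memLp_dilation hA f).toLp _‖ = ‖f‖
    rw [Lp.norm_toLp, eLpNorm_dilation hA, Lp.norm_def]

theorem dilationₗᵢ_coeFn {n : ℕ} (A : Matrix (Fin n) (Fin n) ℝ) (hA : A.det ≠ 0) (f : L2 n) :
    dilationₗᵢ A hA f =ᵐ[volume]
      fun x : Rn n => ((Real.sqrt |A.det| : ℝ) : ℂ) • f (act A x) :=
  (memLp_dilation hA f).coeFn_toLp

theorem dilationₗᵢ_surjective {n : ℕ} (A : Matrix (Fin n) (Fin n) ℝ) (hA : A.det ≠ 0) :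
    Function.Surjective (dilationₗᵢ A hA) := by
  intro g
  have hA' : (A⁻¹).det ≠ 0 := by
    rw [Matrix.det_nonsing_inv]; simpa using hA
  refine ⟨dilationₗᵢ A⁻¹ hA' g, ?_⟩
  apply Lp.ext
  filter_upwards [dilationₗᵢ_coeFn A hA (dilationₗᵢ A⁻¹ hA' g),
    (quasiMeasurePreserving_act hA).ae (dilationₗᵢ_coeFn A⁻¹ hA' g)] with x h1 h2
  have h3 : act A⁻¹ (act A x) = x := by
    simp [act, Matrix.toEuclideanLin, Matrix.toLpLin_apply, Matrix.mulVec_mulVec,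
      Matrix.nonsing_inv_mul A (isUnit_iff_ne_zero.mpr hA)]
  have h4 : Real.sqrt |A.det| * Real.sqrt |(A⁻¹).det| = 1 := by
    rw [← Real.sqrt_mul (abs_nonneg _), ← abs_mul, ← Matrix.det_mul,
      Matrix.mul_nonsing_inv A (isUnit_iff_ne_zero.mpr hA)]
    simp
  rw [h1, h2, h3, smul_smul, ← Complex.ofReal_mul, h4]
  simp

/-- The dilation operator `(D_A f)(x) = |det A|^{1/2} f (A x)` as a unitary of `L²(ℝⁿ)`. Its integer
powers are taken in the group of unitaries. -/
def dilation {n : ℕ} (A : Matrix (Fin n) (Fin n) ℝ) (hA : A.det ≠ 0) : L2 n ≃ₗᵢ[ℂ] L2 n :=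
  LinearIsometryEquiv.ofSurjective (dilationₗᵢ A hA) (dilationₗᵢ_surjective A hA)

theorem dilation_coeFn {n : ℕ} (A : Matrix (Fin n) (Fin n) ℝ) (hA : A.det ≠ 0) (f : L2 n) :
    dilation A hA f =ᵐ[volume]
      fun x : Rn n => ((Real.sqrt |A.det| : ℝ) : ℂ) • f (act A x) :=
  dilationₗᵢ_coeFn A hA f

/-- `V_j = D_A^j V` for an integer `j`. -/
def dilate {n : ℕ} (A : Matrix (Fin n) (Fin n) ℝ) (hA : A.det ≠ 0) (j : ℤ)
    (V : Submodule ℂ (L2 n)) : Submodule ℂ (L2 n) :=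
  V.map ((dilation A hA ^ j : L2 n ≃ₗᵢ[ℂ] L2 n).toLinearEquiv : L2 n →ₗ[ℂ] L2 n)

/-- A closed subspace `V` of `L²(ℝⁿ)` with `T_k V = V` for all `k ∈ ℤⁿ`. -/
structure IsShiftInvariant {n : ℕ} (V : Submodule ℂ (L2 n)) : Prop where
  isClosed : IsClosed (V : Set (L2 n))
  map_translation : ∀ k : Fin n → ℤ, V.map (translation k).toLinearMap = V

/-- A family of vectors of a subspace `V` is a normalized tight frame for `V`:
`∑ i, |⟨f, e i⟩|² = ‖f‖²` for all `f ∈ V`. -/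
structure IsNTF {H : Type*} [NormedAddCommGroup H] [InnerProductSpace ℂ H] {ι : Type*}
    (V : Submodule ℂ H) (e : ι → H) : Prop where
  mem : ∀ i, e i ∈ V
  hasSum : ∀ f ∈ V, HasSum (fun i => ‖inner ℂ (e i) f‖ ^ 2) (‖f‖ ^ 2)

/-- `Φ` is a normalized tight frame generator for `V`: `Φ ⊆ V`, and the family
`(T_k φ)`, indexed by the pairs `(k, φ)`, is a normalized tight frame for `V`. -/
structure IsNTFGenerator {n : ℕ} (V : Submodule ℂ (L2 n)) (Φ : Set (L2 n)) : Prop where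
  subset : Φ ⊆ (V : Set (L2 n))
  isNTF : IsNTF V (fun p : (Fin n → ℤ) × Φ => translation p.1 (p.2 : L2 n))

/-- The Fourier transform on `L²(ℝⁿ)` normalized as `f̂(ξ) = ∫ f(x) e^{-i⟨x, ξ⟩} dx`. As
`𝓕 f (w) = ∫ f(x) e^{-2πi⟨x, w⟩} dx`, one has `f̂(ξ) = 𝓕 f (ξ / 2π)`. -/
def hat {n : ℕ} (f : L2 n) (ξ : Rn n) : ℂ := (𝓕 f : L2 n) ((2 * Real.pi)⁻¹ • ξ)

end

end RefinableNTF

namespace RefinableNTF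

noncomputable section

/-! Write `𝓕` for the unitary Fourier transform, `N = (A*)⁻¹`, `s = ∑ |𝓕 φ|²` (`spectralSum`), `P_j`
for the orthogonal projection onto `V_j`, and `f_E` for the function with `𝓕 f_E = 1_E`
(`bandIndicator`). The proof rests on the identity `‖P_j f_E‖² = ∫_E s(N^j w) dw`, valid as soon as
`N^j E` lies in the unit cube (`enorm_starProjection_bandIndicator_sq`). Indeed the vectors `D_A^j
T_k φ` form a normalized tight frame of `V_j`, and for fixed `φ` their inner products with `f_E`
are, up to conjugation and a constant, the Fourier coefficients of `𝓕 φ` cut off to `N^j E`;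
Parseval on the cube sums them over `k`. Since `A` is expansive, every bounded `E` is eventually
admissible.

Refinability makes `‖P_j f_E‖²` increase with `j`, and it never exceeds `‖f_E‖² = |E|`. As `E` is
arbitrary inside a ball, `s(N^j w)` is, for large `j`, increasing and at most `1` almost everywhere
there. If the `V_j` have dense union, then `∫_B s(N^j w) dw → |B|` on each ball `B`, which together
with monotonicity and the bound forces `s(N^j w) → 1` a.e. Conversely, dominated convergence shows
that `f_E` lies in the closure of the union for compact `E`, and these functions span a dense
subspace. -/

/-! ### Matrix actions and change of variables. -/

theorem det_transpose_inv_ne_zero {n : ℕ} {A : Matrix (Fin n) (Fin n) ℝ} (hA : A.det ≠ 0) :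
    (A.transpose⁻¹).det ≠ 0 := by
  rw [Matrix.det_nonsing_inv, Matrix.det_transpose]
  simpa using hA

theorem act_mul {n : ℕ} (A B : Matrix (Fin n) (Fin n) ℝ) (x : Rn n) :
    act (A * B) x = act A (act B x) := by
  simp [act, Matrix.toEuclideanLin]

theorem act_one {n : ℕ} (x : Rn n) : act (1 : Matrix (Fin n) (Fin n) ℝ) x = x := by
  simp [act, Matrix.toEuclideanLin]

theorem act_inv_act {n : ℕ} {A : Matrix (Fin n) (Fin n) ℝ} (hA : A.det ≠ 0) (x : Rn n) :
    act A⁻¹ (act A x) = x := by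
  rw [← act_mul, Matrix.nonsing_inv_mul A (isUnit_iff_ne_zero.mpr hA), act_one]

theorem act_act_inv {n : ℕ} {A : Matrix (Fin n) (Fin n) ℝ} (hA : A.det ≠ 0) (x : Rn n) :
    act A (act A⁻¹ x) = x := by
  rw [← act_mul, Matrix.mul_nonsing_inv A (isUnit_iff_ne_zero.mpr hA), act_one]

theorem inner_act {n : ℕ} (A : Matrix (Fin n) (Fin n) ℝ) (x y : Rn n) :
    inner ℝ (act A x) y = inner ℝ x (act A.transpose y) := by
  simp only [act, EuclideanSpace.inner_eq_star_dotProduct, Matrix.toEuclideanLin,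
    Matrix.toLpLin_apply, star_trivial]
  rw [Matrix.dotProduct_mulVec, Matrix.mulVec_transpose]

/-- An invertible matrix acting on `ℝⁿ` as a continuous linear equivalence. -/
def actEquiv {n : ℕ} (A : Matrix (Fin n) (Fin n) ℝ) (hA : A.det ≠ 0) : Rn n ≃L[ℝ] Rn n :=
  LinearEquiv.toContinuousLinearEquiv
    { act A with
      invFun := act A⁻¹
      left_inv := act_inv_act hA
      right_inv := act_act_inv hA }

theorem measurableEmbedding_act {n : ℕ} {A : Matrix (Fin n) (Fin n) ℝ} (hA : A.det ≠ 0) :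
    MeasurableEmbedding (act A : Rn n → Rn n) :=
  (actEquiv A hA).toHomeomorph.measurableEmbedding

theorem integral_comp_act {n : ℕ} {A : Matrix (Fin n) (Fin n) ℝ} (hA : A.det ≠ 0)
    (g : Rn n → ℂ) : ∫ x, g (act A x) = |A.det|⁻¹ • ∫ x, g x := by
  have h := (measurableEmbedding_act hA).integral_map (μ := volume) g
  rw [← h, map_act_volume hA, integral_smul_measure, ENNReal.toReal_ofReal (by positivity)]

theorem lintegral_comp_act {n : ℕ} {A : Matrix (Fin n) (Fin n) ℝ} (hA : A.det ≠ 0)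
    (g : Rn n → ℝ≥0∞) : ∫⁻ x, g (act A x) = ENNReal.ofReal |A.det|⁻¹ * ∫⁻ x, g x := by
  have h := (measurableEmbedding_act hA).lintegral_map (μ := volume) g
  rw [← h, map_act_volume hA, lintegral_smul_measure, smul_eq_mul]

/-! ### Translations and dilations on the Fourier side. -/

theorem memLp_modulation {n : ℕ} (a : Rn n) (f : L2 n) :
    MemLp (fun x : Rn n => (Real.fourierChar (-(inner ℝ a x)) : Circle) • f x) 2 volume := by
  have hm : AEStronglyMeasurable
      (fun x : Rn n => (Real.fourierChar (-(inner ℝ a x)) : Circle) • f x) volume := by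
    simp only [Circle.smul_def, smul_eq_mul]
    refine AEStronglyMeasurable.mul ?_ (Lp.aestronglyMeasurable f)
    exact (continuous_subtype_val.comp
      (Real.continuous_fourierChar.comp (by fun_prop))).aestronglyMeasurable
  exact (Lp.memLp f).of_le hm (ae_of_all _ fun x => by
    rw [Circle.smul_def, norm_smul, Circle.norm_coe, one_mul])

/-- The modulation operator `f ↦ e^{-2πi⟨a, ·⟩} f` on `L²(ℝⁿ)`. -/
def modulation {n : ℕ} (a : Rn n) : L2 n →ₗᵢ[ℂ] L2 n where
  toFun f := (memLp_modulation a f).toLp _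
  map_add' f g := by
    apply Lp.ext
    filter_upwards [(memLp_modulation a (f + g)).coeFn_toLp, (memLp_modulation a f).coeFn_toLp,
      (memLp_modulation a g).coeFn_toLp, Lp.coeFn_add f g,
      Lp.coeFn_add ((memLp_modulation a f).toLp _) ((memLp_modulation a g).toLp _)]
      with x h1 h2 h3 h4 h5
    rw [h1, h5, Pi.add_apply, h2, h3, h4, Pi.add_apply, smul_add]
  map_smul' c f := by
    apply Lp.ext
    filter_upwards [(memLp_modulation a (c • f)).coeFn_toLp, (memLp_modulation a f).coeFn_toLp,
      Lp.coeFn_smul c f, Lp.coeFn_smul c ((memLp_modulation a f).toLp _)] with x h1 h2 h3 h4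
    rw [h1, RingHom.id_apply, h4, Pi.smul_apply, h2, h3, Pi.smul_apply, smul_comm]
  norm_map' f := by
    change ‖(memLp_modulation a f).toLp _‖ = ‖f‖
    rw [Lp.norm_toLp, Lp.norm_def]
    congr 1
    exact eLpNorm_congr_norm_ae (ae_of_all _ fun x => by
    rw [Circle.smul_def, norm_smul, Circle.norm_coe, one_mul])

theorem modulation_coeFn {n : ℕ} (a : Rn n) (f : L2 n) :
    modulation a f =ᵐ[volume]
      fun x : Rn n => (Real.fourierChar (-(inner ℝ a x)) : Circle) • f x :=
  (memLp_modulation a f).coeFn_toLp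

theorem translation_coeFn {n : ℕ} (k : Fin n → ℤ) (f : L2 n) :
    translation k f =ᵐ[volume] fun x : Rn n => f (x - latticePt k) :=
  Lp.coeFn_compMeasurePreserving f (measurePreserving_sub_right volume (latticePt k))

/-- Two continuous operators on `L²(ℝⁿ)` that agree on Schwartz functions are equal. -/
theorem eq_of_eq_on_schwartz {n : ℕ} {S T : L2 n → L2 n} (hS : Continuous S) (hT : Continuous T)
    (h : ∀ f : SchwartzMap (Rn n) ℂ, S (f.toLp 2) = T (f.toLp 2)) : S = T :=
  (SchwartzMap.denseRange_toLpCLM (E := Rn n) (F := ℂ) (p := 2) (μ := volume)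
    ENNReal.ofNat_ne_top).equalizer hS hT (funext h)

theorem continuous_fourier_L2 {n : ℕ} : Continuous (fun f : L2 n => (𝓕 f : L2 n)) :=
  (Lp.fourierTransformₗᵢ (Rn n) ℂ).continuous

theorem fourier_translation {n : ℕ} (k : Fin n → ℤ) (f : L2 n) :
    (𝓕 (translation k f) : L2 n) = modulation (latticePt k) (𝓕 f) := by
  refine congrFun (eq_of_eq_on_schwartz (S := fun f => 𝓕 (translation k f))
    (T := fun f => modulation (latticePt k) (𝓕 f))
    (continuous_fourier_L2.comp (translation k).continuous)
    ((modulation _).continuous.comp continuous_fourier_L2) fun f => ?_) f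
  have h1 : translation k (f.toLp 2) = (f.compSubConstCLM ℂ (latticePt k)).toLp 2 := by
    apply Lp.ext
    filter_upwards [translation_coeFn k (f.toLp 2),
      SchwartzMap.coeFn_toLp (f.compSubConstCLM ℂ (latticePt k)) 2 volume,
      (measurePreserving_sub_right volume (latticePt k)).quasiMeasurePreserving.ae
        (SchwartzMap.coeFn_toLp f 2 volume)] with x hx1 hx2 hx3
    rw [hx1, hx2, hx3, SchwartzMap.compSubConstCLM_apply]
  simp only [h1, SchwartzMap.toLp_fourier_eq]
  apply Lp.ext
  filter_upwards [modulation_coeFn (latticePt k) ((𝓕 f).toLp 2),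
    SchwartzMap.coeFn_toLp (𝓕 f) 2 volume,
    SchwartzMap.coeFn_toLp (𝓕 (f.compSubConstCLM ℂ (latticePt k))) 2 volume] with w h2 h3 h4
  rw [h2, h3, h4, SchwartzMap.fourier_coe, SchwartzMap.fourier_coe, Real.fourier_eq,
    Real.fourier_eq, ← integral_add_right_eq_self _ (latticePt k), Circle.smul_def,
    ← integral_smul]
  congr 1
  ext v
  simp only [SchwartzMap.compSubConstCLM_apply, add_sub_cancel_right, inner_add_left, neg_add,
    AddChar.map_add_eq_mul, Circle.smul_def, smul_smul, Circle.coe_mul, mul_comm]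

theorem fourier_dilation {n : ℕ} (A : Matrix (Fin n) (Fin n) ℝ) (hA : A.det ≠ 0) (f : L2 n) :
    (𝓕 (dilation A hA f) : L2 n) =
      dilation A.transpose⁻¹ (det_transpose_inv_ne_zero hA) (𝓕 f) := by
  refine congrFun (eq_of_eq_on_schwartz (S := fun f => 𝓕 (dilation A hA f))
    (T := fun f => dilation A.transpose⁻¹ (det_transpose_inv_ne_zero hA) (𝓕 f))
    (continuous_fourier_L2.comp (dilation A hA).continuous)
    ((dilation _ _).continuous.comp continuous_fourier_L2) fun f => ?_) f
  have hpos : 0 < |A.det| := abs_pos.mpr hA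
  set c : ℂ := ((Real.sqrt |A.det| : ℝ) : ℂ) with hc
  set g := c • SchwartzMap.compCLMOfContinuousLinearEquiv ℂ (actEquiv A hA) f with hg
  have h1 : dilation A hA (f.toLp 2) = g.toLp 2 := by
    apply Lp.ext
    filter_upwards [dilation_coeFn A hA (f.toLp 2), SchwartzMap.coeFn_toLp g 2 volume,
      (quasiMeasurePreserving_act hA).ae (SchwartzMap.coeFn_toLp f 2 volume)] with x hx1 hx2 hx3
    rw [hx1, hx2, hx3]
    rfl
  simp only [h1, SchwartzMap.toLp_fourier_eq]
  apply Lp.ext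
  filter_upwards [dilation_coeFn A.transpose⁻¹ (det_transpose_inv_ne_zero hA) ((𝓕 f).toLp 2),
    (quasiMeasurePreserving_act (det_transpose_inv_ne_zero hA)).ae
      (SchwartzMap.coeFn_toLp (𝓕 f) 2 volume),
    SchwartzMap.coeFn_toLp (𝓕 g) 2 volume] with w h2 h3 h4
  rw [h2, h3, h4, SchwartzMap.fourier_coe, SchwartzMap.fourier_coe, Real.fourier_eq,
    Real.fourier_eq]
  have h5 : ∀ v, (Real.fourierChar (-(inner ℝ v w)) : Circle) • g v =
      c • ((fun y => (Real.fourierChar (-(inner ℝ y (act A.transpose⁻¹ w))) : Circle) • f y)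
        (act A v)) := by
    intro v
    -- The substitution `y = A v` leaves the phase unchanged once `w` is replaced by its image under
    -- the inverse transpose; the Jacobian then turns `|det A|^{1/2}` into `|det A|^{-1/2}`.
    have : inner ℝ (act A v) (act A.transpose⁻¹ w) = inner ℝ v w := by
      rw [inner_act, act_act_inv (by rwa [Matrix.det_transpose])]
    simp only [this]
    rw [smul_comm]
    rfl
  rw [integral_congr_ae (ae_of_all _ h5), integral_smul, integral_comp_act hA
    (fun y => (Real.fourierChar (-(inner ℝ y (act A.transpose⁻¹ w))) : Circle) • f y),
    ← Complex.coe_smul, smul_smul]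
  congr 1
  rw [hc, ← Complex.ofReal_mul, Matrix.det_nonsing_inv, Matrix.det_transpose, Ring.inverse_eq_inv,
    abs_inv, Real.sqrt_inv]
  congr 1
  have := Real.mul_self_sqrt hpos.le
  have h0 : Real.sqrt |A.det| ≠ 0 := (Real.sqrt_pos.mpr hpos).ne'
  field_simp
  rw [sq, this]

/-! ### Expansiveness: powers of the inverse transpose contract bounded sets. -/

section Expansive

attribute [local instance] Matrix.linftyOpNormedAddCommGroup Matrix.linftyOpNormedRing
  Matrix.linftyOpNormedAlgebra

/-- Gelfand: powers of an element of spectral radius less than one tend to zero. -/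
theorem tendsto_pow_of_spectralRadius_lt_one {R : Type*} [NormedRing R] [NormedAlgebra ℂ R]
    [CompleteSpace R] (a : R) (h : spectralRadius ℂ a < 1) :
    Tendsto (fun j : ℕ => a ^ j) atTop (𝓝 0) := by
  obtain ⟨r, hr1, hr2⟩ := exists_between h
  have h1 := (spectrum.pow_nnnorm_pow_one_div_tendsto_nhds_spectralRadius a).eventually_lt_const hr1
  rw [tendsto_zero_iff_norm_tendsto_zero]
  lift r to NNReal using hr2.ne_top
  have hr : r < 1 := by exact_mod_cast hr2
  refine squeeze_zero' (Eventually.of_forall fun _ => norm_nonneg _) (g := fun j => (r : ℝ) ^ j) ?_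
    (tendsto_pow_atTop_nhds_zero_of_lt_one r.2 hr)
  filter_upwards [h1, eventually_gt_atTop 0] with j hj hj0
  have h2 : (‖a ^ j‖₊ : ℝ≥0∞) ≤ (r : ℝ≥0∞) ^ j := by
    have h3 := ENNReal.rpow_le_rpow hj.le (Nat.cast_nonneg (α := ℝ) j)
    rwa [← ENNReal.rpow_mul, one_div, inv_mul_cancel₀ (by positivity), ENNReal.rpow_one,
      ENNReal.rpow_natCast] at h3
  exact_mod_cast h2

/-- The eigenvalues of the inverse are reciprocals of those of `A`, so over `ℂ` its spectral radius
is below one and Gelfand's formula applies. Entrywise convergence makes it easy to pass back to `ℝ`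
and to the transpose. -/
theorem IsDilationMatrix.tendsto_inv_pow {n : ℕ} {A : Matrix (Fin n) (Fin n) ℝ}
    (hA : IsDilationMatrix A) (i l : Fin n) :
    Tendsto (fun j : ℕ => ((A.transpose⁻¹) ^ j) i l) atTop (𝓝 0) := by
  set C : Matrix (Fin n) (Fin n) ℂ := A.map ((↑) : ℝ → ℂ) with hC
  have hdet : IsUnit C := by
    rw [Matrix.isUnit_iff_isUnit_det, isUnit_iff_ne_zero]
    have := Complex.ofRealHom.map_det A
    intro h0
    exact hA.det_ne_zero (Complex.ofReal_injective (this.trans h0))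
  have hrad : spectralRadius ℂ C⁻¹ < 1 := by
    -- For `n = 0` the matrix ring is trivial, so no spectral value attains the spectral radius; it
    -- is simply zero.
    cases isEmpty_or_nonempty (Fin n) with
    | inl h =>
      rw [Subsingleton.elim C⁻¹ 0]
      simp
    | inr h =>
      have : Nontrivial (Matrix (Fin n) (Fin n) ℂ) := inferInstance
      obtain ⟨z, hz, hz'⟩ := spectrum.exists_nnnorm_eq_spectralRadius C⁻¹
      rw [← hz']
      obtain ⟨u, hu⟩ := hdet
      have hz0 : z ≠ 0 := by
        rintro rfl
        rw [spectrum.zero_mem_iff] at hz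
        exact hz ((Matrix.isUnit_nonsing_inv_iff).2 ⟨u, hu⟩)
      have h2 : z⁻¹ ∈ spectrum ℂ C := by
        rw [← hu] at hz ⊢
        rw [← Matrix.coe_units_inv] at hz
        exact (spectrum.inv_mem_iff (r := Units.mk0 z⁻¹ (inv_ne_zero hz0))).2 (by simpa using hz)
      rw [← Matrix.spectrum_toLin', ← Module.End.hasEigenvalue_iff_mem_spectrum] at h2
      have h3 := hA.one_lt_norm_eigenvalue _ h2
      rw [norm_inv] at h3
      have h4 : ‖z‖ < 1 := by
        by_contra h
        exact absurd (inv_le_one_of_one_le₀ (not_lt.mp h)) (not_le.mpr h3)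
      exact_mod_cast h4
  have h5 := tendsto_pow_of_spectralRadius_lt_one C⁻¹ hrad
  have h6 : Tendsto (fun j : ℕ => (C⁻¹ ^ j) l i) atTop (𝓝 0) := by
    have := ((continuous_apply i).comp (continuous_apply l)).tendsto (0 : Matrix (Fin n) (Fin n) ℂ)
    exact this.comp h5
  have h7 : ∀ j : ℕ, (C⁻¹ ^ j) l i = (((A.transpose⁻¹) ^ j) i l : ℝ) := by
    intro j
    have h8 : C⁻¹ = A⁻¹.map Complex.ofRealHom := by
      refine Matrix.inv_eq_left_inv ?_
      change A⁻¹.map Complex.ofRealHom * A.map Complex.ofRealHom = 1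
      rw [← Matrix.map_mul, Matrix.nonsing_inv_mul A (isUnit_iff_ne_zero.mpr hA.det_ne_zero)]
      simp
    rw [h8, ← Matrix.transpose_nonsing_inv, ← Matrix.transpose_pow, Matrix.transpose_apply]
    rw [← Complex.ofRealHom.mapMatrix_apply, ← map_pow]
    rfl
  simp only [h7] at h6
  simpa [Function.comp_def] using (Complex.continuous_re.tendsto 0).comp h6

end Expansive

/-- The cube `(-1/2, 1/2]ⁿ`. -/
def unitCube (n : ℕ) : Set (Rn n) := {w | ∀ i, w i ∈ Set.Ioc (-(1 / 2) : ℝ) (-(1 / 2) + 1)}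

theorem IsDilationMatrix.eventually_act_mem_unitCube {n : ℕ} {A : Matrix (Fin n) (Fin n) ℝ}
    (hA : IsDilationMatrix A) (R : ℝ) :
    ∃ J : ℕ, ∀ j ≥ J, ∀ w : Rn n, ‖w‖ ≤ R → act ((A.transpose⁻¹) ^ j) w ∈ unitCube n := by
  have h1 : Tendsto (fun j : ℕ => ∑ i, ∑ l, |((A.transpose⁻¹) ^ j) i l| * R) atTop (𝓝 0) := by
    have : Tendsto (fun j : ℕ => ∑ i, ∑ l, |((A.transpose⁻¹) ^ j) i l| * R) atTop
        (𝓝 (∑ i : Fin n, ∑ l : Fin n, |(0 : ℝ)| * R)) :=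
      tendsto_finsetSum _ fun i _ => tendsto_finsetSum _ fun l _ =>
        ((hA.tendsto_inv_pow i l).abs.mul_const R)
    simpa using this
  -- The strict bound `1 / 2` on each coordinate makes the excluded face of the half-open cube
  -- irrelevant.
  obtain ⟨J, hJ⟩ := eventually_atTop.1 (h1.eventually_lt_const (show (0 : ℝ) < 1 / 2 by norm_num))
  refine ⟨J, fun j hj w hw i => ?_⟩
  have hR : 0 ≤ R := (norm_nonneg _).trans hw
  have h2 : |act ((A.transpose⁻¹) ^ j) w i| ≤ ∑ l, |((A.transpose⁻¹) ^ j) i l| * R := by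
    simp only [act, Matrix.toEuclideanLin, Matrix.toLpLin_apply, Matrix.mulVec, dotProduct]
    refine (Finset.abs_sum_le_sum_abs _ _).trans (Finset.sum_le_sum fun l _ => ?_)
    rw [abs_mul]
    exact mul_le_mul_of_nonneg_left ((PiLp.norm_apply_le w l).trans hw) (abs_nonneg _)
  have h3 : ∑ l, |((A.transpose⁻¹) ^ j) i l| * R ≤
      ∑ i, ∑ l, |((A.transpose⁻¹) ^ j) i l| * R :=
    Finset.single_le_sum (f := fun i => ∑ l, |((A.transpose⁻¹) ^ j) i l| * R)
      (fun i _ => Finset.sum_nonneg fun l _ => mul_nonneg (abs_nonneg _) hR) (Finset.mem_univ i)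
  have h4 := abs_lt.1 ((h2.trans h3).trans_lt (hJ j hj))
  constructor <;> linarith [h4.1, h4.2]

theorem measurableSet_unitCube (n : ℕ) : MeasurableSet (unitCube n) :=
  (WithLp.measurable_ofLp 2 (Fin n → ℝ))
    (MeasurableSet.univ_pi' (t := fun _ : Fin n => Set.Ioc (-(1 / 2) : ℝ) (-(1 / 2) + 1))
      fun _ => measurableSet_Ioc)

/-! ### Parseval's identity on the unit cube. -/

section Parseval

-- Haar measure of total mass one, for which the exponentials are orthonormal.
local instance : MeasureSpace UnitAddCircle := ⟨AddCircle.haarAddCircle⟩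

local instance : Measure.IsAddHaarMeasure (volume : Measure UnitAddCircle) :=
  inferInstanceAs (Measure.IsAddHaarMeasure AddCircle.haarAddCircle)

local instance : IsProbabilityMeasure (volume : Measure UnitAddCircle) :=
  inferInstanceAs (IsProbabilityMeasure AddCircle.haarAddCircle)

theorem tsum_mFourierCoeff_sq {d : Type*} [Fintype d] {F : UnitAddTorus d → ℂ}
    (hF : MemLp F 2 volume) :
    ∑' k, ‖UnitAddTorus.mFourierCoeff F k‖ₑ ^ 2 = ∫⁻ t, ‖F t‖ₑ ^ 2 := by
  have h1 := UnitAddTorus.hasSum_sq_mFourierCoeff (hF.toLp F)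
  have h2 : ∀ k, UnitAddTorus.mFourierCoeff (hF.toLp F) k = UnitAddTorus.mFourierCoeff F k :=
    fun k => integral_congr_ae (hF.coeFn_toLp.mono fun t ht => by simp only [ht])
  have h3 : ∫ t, ‖hF.toLp F t‖ ^ 2 = ∫ t, ‖F t‖ ^ 2 :=
    integral_congr_ae (hF.coeFn_toLp.mono fun t ht => by simp only [ht])
  simp only [h2, h3] at h1
  have h4 : ∀ z : ℂ, ‖z‖ₑ ^ 2 = ENNReal.ofReal (‖z‖ ^ 2) := fun z => by
    rw [← ofReal_norm, ENNReal.ofReal_pow (norm_nonneg _)]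
  simp only [h4]
  rw [← ENNReal.ofReal_tsum_of_nonneg (fun _ => by positivity) h1.summable, h1.tsum_eq,
    ofReal_integral_eq_lintegral_ofReal ((memLp_two_iff_integrable_sq_norm hF.1).1 hF)
      (ae_of_all _ fun _ => by positivity)]

theorem mFourier_coe {n : ℕ} (k : Fin n → ℤ) (x : Rn n) :
    UnitAddTorus.mFourier k (fun i => (x i : UnitAddCircle)) =
      ((Real.fourierChar (inner ℝ (latticePt k) x) : Circle) : ℂ) := by
  simp only [UnitAddTorus.mFourier, ContinuousMap.coe_mk, fourier_coe_apply,
    Real.fourierChar_apply, ← Complex.exp_sum]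
  congr 1
  simp only [latticePt, EuclideanSpace.inner_eq_star_dotProduct, dotProduct, star_trivial]
  push_cast
  rw [Finset.mul_sum, Finset.sum_mul]
  refine Finset.sum_congr rfl fun i _ => ?_
  ring

/-- Parseval's identity for Fourier series on the cube `(-1/2, 1/2]ⁿ`. -/
theorem tsum_setIntegral_unitCube_sq {n : ℕ} {h : Rn n → ℂ} (hm : Measurable h)
    (hfin : ∫⁻ w in unitCube n, ‖h w‖ₑ ^ 2 ≠ ∞) :
    ∑' k : Fin n → ℤ,
        ‖∫ w in unitCube n, ((Real.fourierChar (inner ℝ (latticePt k) w) : Circle) : ℂ) * h w‖ₑ ^ 2 =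
      ∫⁻ w in unitCube n, ‖h w‖ₑ ^ 2 := by
  set a : Fin n → ℝ := fun _ => -(1 / 2) with ha
  set Q : Set (Fin n → ℝ) := {x | ∀ i, x i ∈ Set.Ioc (a i) (a i + 1)} with hQ
  have hQm : MeasurableSet Q := MeasurableSet.univ_pi' fun i => measurableSet_Ioc
  set F : UnitAddTorus (Fin n) → ℂ :=
    fun t => h (WithLp.toLp 2 (UnitAddTorus.measurableEquivPiIoc a t).1) with hF
  have hFm : Measurable F := hm.comp ((WithLp.measurable_toLp 2 _).comp
    (measurable_subtype_coe.comp (UnitAddTorus.measurableEquivPiIoc a).measurable))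
  have hFc : ∀ x ∈ Q, F (fun i => (x i : UnitAddCircle)) = h (WithLp.toLp 2 x) := by
    intro x hx
    have := (UnitAddTorus.measurableEquivPiIoc a).apply_symm_apply ⟨x, hx⟩
    rw [UnitAddTorus.coe_symm_measurableEquivPiIoc_apply] at this
    simp only [hF, this]
  have hcube := measurableSet_unitCube n
  have hmp := (PiLp.volume_preserving_toLp (Fin n)).restrict_preimage hcube
  have hemb : MeasurableEmbedding (WithLp.toLp 2 : (Fin n → ℝ) → Rn n) :=
    (MeasurableEquiv.toLp 2 (Fin n → ℝ)).measurableEmbedding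
  have hlin : ∫⁻ t, ‖F t‖ₑ ^ 2 = ∫⁻ w in unitCube n, ‖h w‖ₑ ^ 2 := by
    rw [UnitAddTorus.lintegral_preimage _ a, ← hmp.lintegral_comp_emb hemb]
    exact setLIntegral_congr_fun hQm fun x hx => by simp only [hFc x hx]
  have hL : MemLp F 2 volume := by
    refine ⟨hFm.aestronglyMeasurable, ?_⟩
    rw [eLpNorm_lt_top_iff_lintegral_rpow_enorm_lt_top (by simp) (by simp)]
    simp only [ENNReal.toReal_ofNat, ENNReal.rpow_ofNat]
    rw [hlin]
    exact hfin.lt_top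
  -- A Fourier coefficient pairs with the character of `-k`, hence the reindexing by negation.
  rw [← hlin, ← tsum_mFourierCoeff_sq hL, ← (Equiv.neg (Fin n → ℤ)).tsum_eq]
  refine tsum_congr fun k => ?_
  congr 2
  rw [UnitAddTorus.mFourierCoeff_eq_integral _ _ a, ← hmp.integral_comp hemb]
  refine setIntegral_congr_fun hQm fun x hx => ?_
  simp only [hFc x hx, smul_eq_mul]
  rw [← mFourier_coe]
  rfl

end Parseval

/-! ### Band-limited test functions and their frame coefficients. -/

theorem lintegral_enorm_sq_L2_ne_top {n : ℕ} (f : L2 n) : ∫⁻ w, ‖f w‖ₑ ^ 2 ≠ ∞ := by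
  have h := (eLpNorm_lt_top_iff_lintegral_rpow_enorm_lt_top (by simp) (by simp)).1
    (Lp.eLpNorm_lt_top f)
  simpa using h.ne

theorem latticePt_neg {n : ℕ} (k : Fin n → ℤ) : latticePt (-k) = -latticePt k := by
  ext i
  simp [latticePt]

/-- The function whose Fourier transform is the indicator function of `E`. -/
def bandIndicator {n : ℕ} {E : Set (Rn n)} (hE : MeasurableSet E) (hv : volume E ≠ ∞) : L2 n :=
  𝓕⁻ (indicatorConstLp 2 hE hv (1 : ℂ) : L2 n)

theorem fourier_bandIndicator {n : ℕ} {E : Set (Rn n)} (hE : MeasurableSet E)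
    (hv : volume E ≠ ∞) :
    (𝓕 (bandIndicator hE hv) : L2 n) = indicatorConstLp 2 hE hv (1 : ℂ) :=
  FourierTransform.fourier_fourierInv_eq _

theorem inner_bandIndicator {n : ℕ} {E : Set (Rn n)} (hE : MeasurableSet E)
    (hv : volume E ≠ ∞) (f : L2 n) :
    inner ℂ (bandIndicator hE hv) f = ∫ w in E, (𝓕 f : L2 n) w := by
  rw [← Lp.inner_fourier_eq, fourier_bandIndicator, L2.inner_indicatorConstLp_one]

theorem enorm_bandIndicator_sq {n : ℕ} {E : Set (Rn n)} (hE : MeasurableSet E)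
    (hv : volume E ≠ ∞) : ‖bandIndicator hE hv‖ₑ ^ 2 = volume E := by
  have h1 : ‖bandIndicator hE hv‖ = ‖(indicatorConstLp 2 hE hv (1 : ℂ) : L2 n)‖ := by
    rw [← fourier_bandIndicator, Lp.norm_fourier_eq]
  rw [← ofReal_norm, h1, norm_indicatorConstLp (by simp) (by simp), norm_one, one_mul,
    ← ENNReal.ofReal_pow (by positivity), ← Real.rpow_natCast, ← Real.rpow_mul (by positivity)]
  simp [Measure.real, hv]

/-- With `N` the inverse transpose of `M`, the transform of `D_M T_k φ` at `w` is `|det N|^{1/2}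
e^{-2πi⟨k, N w⟩} (𝓕 φ)(N w)`. Substituting `u = N w` turns its integral over `E` into a Fourier
coefficient of `𝓕 φ` cut off to `N E`. Because `N E` lies in one cube there is no periodization
overlap, and Parseval applies to the cut-off function itself. -/
theorem tsum_inner_dilation_translation_bandIndicator {n : ℕ} {M : Matrix (Fin n) (Fin n) ℝ}
    (hM : M.det ≠ 0) {E : Set (Rn n)} (hE : MeasurableSet E) (hv : volume E ≠ ∞)
    (hEQ : ∀ w ∈ E, act M.transpose⁻¹ w ∈ unitCube n) (φ : L2 n) :
    ∑' k : Fin n → ℤ,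
        ‖inner ℂ (dilation M hM (translation k φ)) (bandIndicator hE hv)‖ₑ ^ 2 =
      ∫⁻ w in E, ‖(𝓕 φ : L2 n) (act M.transpose⁻¹ w)‖ₑ ^ 2 := by
  set N := M.transpose⁻¹ with hN
  have hNd : N.det ≠ 0 := det_transpose_inv_ne_zero hM
  have hMt : M.transpose.det ≠ 0 := by rwa [Matrix.det_transpose]
  have hpos : 0 < |N.det| := abs_pos.mpr hNd
  set ψ : L2 n := 𝓕 φ with hψ
  -- This is the image `N E`, written as a preimage so that measurability is immediate.
  set E' : Set (Rn n) := act M.transpose ⁻¹' E with hE'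
  have hE'm : MeasurableSet E' := measurable_act _ hE
  have hE'w : ∀ w, act N w ∈ E' ↔ w ∈ E := fun w => by
    rw [hE', Set.mem_preimage, hN, act_act_inv hMt]
  have hE'Q : E' ⊆ unitCube n := fun u hu => by
    have := hEQ _ hu
    rwa [hN, act_inv_act hMt] at this
  set h : Rn n → ℂ := E'.indicator ψ with hh
  have hψm : Measurable (ψ : Rn n → ℂ) := (Lp.stronglyMeasurable ψ).measurable
  have hhm : Measurable h := hψm.indicator hE'm
  -- The Jacobian of `u = N w` times the normalization of the dilation. Its square is `|det N|⁻¹`,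
  -- exactly the Jacobian needed to substitute back at the end.
  set c : ℂ := ((|N.det|⁻¹ * Real.sqrt |N.det| : ℝ) : ℂ) with hc
  have hhl : ∫⁻ u in unitCube n, ‖h u‖ₑ ^ 2 = ∫⁻ u, ‖h u‖ₑ ^ 2 := by
    rw [← lintegral_indicator (measurableSet_unitCube n)]
    refine lintegral_congr fun u => ?_
    by_cases hu : u ∈ unitCube n
    · rw [Set.indicator_of_mem hu]
    · rw [Set.indicator_of_notMem hu, hh, Set.indicator_of_notMem fun h' => hu (hE'Q h')]
      simp
  have hfin : ∫⁻ u in unitCube n, ‖h u‖ₑ ^ 2 ≠ ∞ := by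
    refine ne_top_of_le_ne_top (lintegral_enorm_sq_L2_ne_top ψ)
      ((setLIntegral_le_lintegral _ _).trans (lintegral_mono fun u => ?_))
    gcongr
    exact enorm_indicator_le_enorm_self _ _
  set g : (Fin n → ℤ) → Rn n → ℂ := fun k u => ((Real.sqrt |N.det| : ℝ) : ℂ) *
    (((Real.fourierChar (inner ℝ (latticePt (-k)) u) : Circle) : ℂ) * h u) with hg
  have hcoef : ∀ k : Fin n → ℤ,
      ‖inner ℂ (dilation M hM (translation k φ)) (bandIndicator hE hv)‖ₑ ^ 2 =
        ‖c‖ₑ ^ 2 * ‖∫ u in unitCube n,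
          ((Real.fourierChar (inner ℝ (latticePt (-k)) u) : Circle) : ℂ) * h u‖ₑ ^ 2 := by
    intro k
    have h1 : ∫ w in E, (𝓕 (dilation M hM (translation k φ)) : L2 n) w =
        ∫ w, g k (act N w) := by
      rw [← integral_indicator hE]
      refine integral_congr_ae ?_
      rw [fourier_dilation, fourier_translation]
      filter_upwards [dilation_coeFn N hNd (modulation (latticePt k) ψ),
        (quasiMeasurePreserving_act hNd).ae (modulation_coeFn (latticePt k) ψ)] with w h2 h3
      by_cases hw : w ∈ E
      · simp only [hg]
        rw [Set.indicator_of_mem hw, h2, h3, hh, Set.indicator_of_mem ((hE'w w).2 hw),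
          latticePt_neg, inner_neg_left, Circle.smul_def]
        rfl
      · simp only [hg]
        rw [Set.indicator_of_notMem hw, hh,
          Set.indicator_of_notMem (fun h' => hw ((hE'w w).1 h'))]
        simp
    have h4 : ∫ u in unitCube n, ((Real.fourierChar (inner ℝ (latticePt (-k)) u) : Circle) : ℂ) * h u =
        ∫ u, ((Real.fourierChar (inner ℝ (latticePt (-k)) u) : Circle) : ℂ) * h u := by
      refine setIntegral_eq_integral_of_forall_compl_eq_zero fun u hu => ?_
      rw [hh, Set.indicator_of_notMem fun h' => hu (hE'Q h'), mul_zero]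
    have h5 := h1.trans (integral_comp_act hNd (g k))
    rw [← mul_pow, ← enorm_mul, h4]
    congr 1
    rw [← inner_conj_symm, RCLike.enorm_conj, inner_bandIndicator, h5,
      integral_const_mul, hc, ← Complex.coe_smul, smul_eq_mul, ← mul_assoc, Complex.ofReal_mul]
  simp only [hcoef]
  have hsum := ((Equiv.neg (Fin n → ℤ)).tsum_eq _).trans
    ((tsum_setIntegral_unitCube_sq hhm hfin).trans hhl)
  rw [ENNReal.tsum_mul_left]
  refine (congrArg (‖c‖ₑ ^ 2 * ·) hsum).trans ?_
  beta_reduce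
  have hc2 : ‖c‖ₑ ^ 2 = ENNReal.ofReal |N.det|⁻¹ := by
    rw [← ofReal_norm, hc, Complex.norm_real, Real.norm_of_nonneg (by positivity),
      ← ENNReal.ofReal_pow (by positivity), mul_pow, Real.sq_sqrt hpos.le]
    congr 1
    field_simp
  rw [hc2, ← lintegral_comp_act hNd, ← lintegral_indicator hE]
  refine lintegral_congr fun w => ?_
  by_cases hw : w ∈ E
  · rw [Set.indicator_of_mem hw, hh, Set.indicator_of_mem ((hE'w w).2 hw)]
  · rw [Set.indicator_of_notMem hw, hh, Set.indicator_of_notMem (fun h' => hw ((hE'w w).1 h'))]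
    simp

/-! ### Tight frames: projections and countability. -/

/-- Bessel sums of a normalized tight frame compute the norm of the orthogonal projection. -/
theorem IsNTF.tsum_enorm_inner_sq {H : Type*} [NormedAddCommGroup H] [InnerProductSpace ℂ H]
    {ι : Type*} {V : Submodule ℂ H} [V.HasOrthogonalProjection] {e : ι → H} (he : IsNTF V e)
    (f : H) : ∑' i, ‖inner ℂ (e i) f‖ₑ ^ 2 = ‖V.starProjection f‖ₑ ^ 2 := by
  have h1 : ∀ i, inner ℂ (e i) f = inner ℂ (e i) (V.starProjection f) := fun i => by
    rw [← Submodule.inner_starProjection_left_eq_right,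
      Submodule.starProjection_eq_self_iff.2 (he.mem i)]
  have h2 := he.hasSum _ (V.starProjection_apply_mem f)
  have h4 : ∀ z : ℂ, ‖z‖ₑ ^ 2 = ENNReal.ofReal (‖z‖ ^ 2) := fun z => by
    rw [← ofReal_norm, ENNReal.ofReal_pow (norm_nonneg _)]
  simp only [h1, h4]
  rw [← ENNReal.ofReal_tsum_of_nonneg (fun _ => by positivity) h2.summable, h2.tsum_eq,
    ENNReal.ofReal_pow (norm_nonneg _), ofReal_norm]

/-- Countability gives measurability of `spectralSum` and allows the sum over `Φ` to be exchanged
with integrals. A finite Bessel sum has countable support, so each `f` in a countable dense set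
pairs nontrivially with only countably many generators; a generator missed by all of them is zero.
-/
theorem IsNTFGenerator.countable {n : ℕ} {V : Submodule ℂ (L2 n)} [V.HasOrthogonalProjection]
    {Φ : Set (L2 n)} (hΦ : IsNTFGenerator V Φ) : Φ.Countable := by
  have : Fact ((2 : ℝ≥0∞) ≠ ∞) := ⟨by simp⟩
  obtain ⟨D, hDc, hD⟩ := TopologicalSpace.exists_countable_dense (L2 n)
  have h1 : ∀ f : L2 n,
      {φ : Φ | inner ℂ (translation (0 : Fin n → ℤ) (φ : L2 n)) f ≠ 0}.Countable := by
    intro f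
    have h2 : ∑' p : (Fin n → ℤ) × Φ, ‖inner ℂ (translation p.1 (p.2 : L2 n)) f‖ₑ ^ 2 ≠ ∞ := by
      rw [hΦ.isNTF.tsum_enorm_inner_sq f]
      simp
    refine ((Summable.countable_support_ennreal h2).preimage
      (Prod.mk_right_injective (0 : Fin n → ℤ))).mono fun φ hφ => ?_
    simpa using hφ
  have h3 : ((Subtype.val : Φ → L2 n) '' ⋃ f ∈ D,
      {φ : Φ | inner ℂ (translation (0 : Fin n → ℤ) (φ : L2 n)) f ≠ 0}).Countable :=
    (hDc.biUnion fun f _ => h1 f).image _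
  refine (h3.insert 0).mono fun φ hφ => ?_
  by_contra hcon
  rw [Set.mem_insert_iff, not_or] at hcon
  apply hcon.1
  rw [← norm_eq_zero, ← (translation (0 : Fin n → ℤ)).norm_map, norm_eq_zero]
  refine hD.eq_zero_of_inner_left (𝕜 := ℂ) fun f hf => ?_
  by_contra h0
  exact hcon.2 ⟨⟨φ, hφ⟩, Set.mem_biUnion hf h0, rfl⟩

/-! ### Powers of the dilation and the projections onto `V_j`. -/

/-- Composition with matrices reverses products; for powers of a single matrix the order is
immaterial. -/
theorem dilation_mul {n : ℕ} {A B : Matrix (Fin n) (Fin n) ℝ} (hA : A.det ≠ 0) (hB : B.det ≠ 0)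
    (hAB : (A * B).det ≠ 0) : dilation (A * B) hAB = dilation B hB * dilation A hA := by
  ext1 f
  apply Lp.ext
  change _ =ᵐ[volume] dilation B hB (dilation A hA f)
  filter_upwards [dilation_coeFn (A * B) hAB f, dilation_coeFn B hB (dilation A hA f),
    (quasiMeasurePreserving_act hB).ae (dilation_coeFn A hA f)] with x h1 h2 h3
  rw [h1, h2, h3, smul_smul, act_mul, ← Complex.ofReal_mul, ← Real.sqrt_mul (abs_nonneg _),
    ← abs_mul, Matrix.det_mul, mul_comm]

theorem det_pow_ne_zero {n : ℕ} {A : Matrix (Fin n) (Fin n) ℝ} (hA : A.det ≠ 0) (j : ℕ) :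
    (A ^ j).det ≠ 0 := by
  rw [Matrix.det_pow]
  exact pow_ne_zero _ hA

theorem dilation_pow {n : ℕ} {A : Matrix (Fin n) (Fin n) ℝ} (hA : A.det ≠ 0) (j : ℕ) :
    dilation A hA ^ j = dilation (A ^ j) (det_pow_ne_zero hA j) := by
  induction j with
  | zero =>
    ext1 f
    apply Lp.ext
    filter_upwards [dilation_coeFn (A ^ 0) (det_pow_ne_zero hA 0) f] with x hx
    rw [hx]
    simp [act_one]
  | succ j ih =>
    have h := dilation_mul hA (det_pow_ne_zero hA j)
      (by rw [← pow_succ']; exact det_pow_ne_zero hA (j + 1))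
    rw [pow_succ, ih, ← h]
    congr 1
    rw [pow_succ']

theorem dilate_add {n : ℕ} {A : Matrix (Fin n) (Fin n) ℝ} (hA : A.det ≠ 0) (i j : ℤ)
    (V : Submodule ℂ (L2 n)) : dilate A hA (i + j) V = dilate A hA i (dilate A hA j V) := by
  rw [dilate, dilate, dilate, zpow_add, ← Submodule.map_comp]
  rfl

theorem monotone_dilate {n : ℕ} {A : Matrix (Fin n) (Fin n) ℝ} (hA : A.det ≠ 0)
    {V : Submodule ℂ (L2 n)} (hV : V ≤ dilate A hA 1 V) : Monotone fun j => dilate A hA j V := by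
  refine monotone_int_of_le_succ fun j => ?_
  rw [dilate_add]
  exact Submodule.map_mono hV

/-- The spectral sum `∑ φ, |𝓕 φ|²` of a family of functions. -/
def spectralSum {n : ℕ} (Φ : Set (L2 n)) (w : Rn n) : ℝ≥0∞ :=
  ∑' φ : Φ, ‖(𝓕 (φ : L2 n) : L2 n) w‖ₑ ^ 2

theorem measurable_spectralSum {n : ℕ} {Φ : Set (L2 n)} (hΦ : Φ.Countable) :
    Measurable (spectralSum Φ) := by
  have : Countable Φ := hΦ.to_subtype
  exact Measurable.tsum fun φ =>
    ((Lp.stronglyMeasurable (𝓕 (φ : L2 n) : L2 n)).measurable.enorm.pow_const 2)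

theorem transpose_inv_pow {n : ℕ} (A : Matrix (Fin n) (Fin n) ℝ) (j : ℕ) :
    (A ^ j).transpose⁻¹ = A.transpose⁻¹ ^ j := by
  rw [Matrix.transpose_pow, Matrix.inv_pow']

instance hasOrthogonalProjection_dilate {n : ℕ} {A : Matrix (Fin n) (Fin n) ℝ} (hA : A.det ≠ 0)
    (j : ℤ) (V : Submodule ℂ (L2 n)) [V.HasOrthogonalProjection] :
    (dilate A hA j V).HasOrthogonalProjection :=
  inferInstanceAs ((V.map ((dilation A hA ^ j : L2 n ≃ₗᵢ[ℂ] L2 n).toLinearEquiv :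
    L2 n →ₗ[ℂ] L2 n)).HasOrthogonalProjection)

/-- The unitary `D_A^j` carries the projection onto `V` to the projection onto `V_j`, so the frame
identity of `V` computes the norm, and the sum over translates is evaluated one generator at a time.
-/
theorem enorm_starProjection_bandIndicator_sq {n : ℕ} {A : Matrix (Fin n) (Fin n) ℝ}
    (hA : A.det ≠ 0) {V : Submodule ℂ (L2 n)} [V.HasOrthogonalProjection] {Φ : Set (L2 n)}
    (hΦ : IsNTFGenerator V Φ) (j : ℕ)
    {E : Set (Rn n)} (hE : MeasurableSet E) (hv : volume E ≠ ∞)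
    (hEQ : ∀ w ∈ E, act (A.transpose⁻¹ ^ j) w ∈ unitCube n) :
    ‖(dilate A hA j V).starProjection (bandIndicator hE hv)‖ₑ ^ 2 =
      ∫⁻ w in E, spectralSum Φ (act (A.transpose⁻¹ ^ j) w) := by
  have hc : Countable Φ := hΦ.countable.to_subtype
  set U : L2 n ≃ₗᵢ[ℂ] L2 n := dilation A hA ^ (j : ℤ) with hU
  have h1 : (dilate A hA j V).starProjection (bandIndicator hE hv) =
      U (V.starProjection (U.symm (bandIndicator hE hv))) :=
    Submodule.starProjection_map_apply U V _
  have hU' : U = dilation (A ^ j) (det_pow_ne_zero hA j) := by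
    rw [hU, zpow_natCast, dilation_pow]
  have h2 : ∀ p : (Fin n → ℤ) × Φ,
      inner ℂ (translation p.1 (p.2 : L2 n)) (U.symm (bandIndicator hE hv)) =
        inner ℂ (dilation (A ^ j) (det_pow_ne_zero hA j) (translation p.1 (p.2 : L2 n)))
          (bandIndicator hE hv) := fun p => by
    rw [← U.inner_map_map, U.apply_symm_apply, hU']
  rw [h1, ← ofReal_norm, U.norm_map, ofReal_norm, ← hΦ.isNTF.tsum_enorm_inner_sq]
  simp only [h2]
  rw [ENNReal.tsum_prod (f := fun (k : Fin n → ℤ) (φ : Φ) =>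
    ‖inner ℂ (dilation (A ^ j) (det_pow_ne_zero hA j) (translation k (φ : L2 n)))
          (bandIndicator hE hv)‖ₑ ^ 2), ENNReal.tsum_comm]
  rw [← transpose_inv_pow] at hEQ ⊢
  simp only [tsum_inner_dilation_translation_bandIndicator (det_pow_ne_zero hA j) hE hv hEQ,
    spectralSum]
  rw [lintegral_tsum]
  intro φ
  exact (((Lp.stronglyMeasurable (𝓕 (φ : L2 n) : L2 n)).measurable.comp
    (measurable_act _)).enorm.pow_const 2).aemeasurable

/-! ### Pointwise estimates for the spectral sum. -/

theorem norm_starProjection_le_of_le {H : Type*} [NormedAddCommGroup H] [InnerProductSpace ℂ H]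
    {V W : Submodule ℂ H} [V.HasOrthogonalProjection] [W.HasOrthogonalProjection] (h : V ≤ W)
    (f : H) : ‖V.starProjection f‖ ≤ ‖W.starProjection f‖ := by
  have h1 : V.starProjection f = V.starProjection (W.starProjection f) := by
    rw [Submodule.starProjection_apply, Submodule.starProjection_apply V,
      Submodule.orthogonalProjectionOnto_starProjection_of_le h]
  rw [h1]
  exact V.norm_starProjection_apply_le _

/-- An a.e. inequality follows from the integral inequality over every measurable subset. One `J`
serves all subsets of the ball, and on each of them the integrals are squared norms of projections
onto nested spaces. -/
theorem ae_spectralSum_mono {n : ℕ} {A : Matrix (Fin n) (Fin n) ℝ} (hA : A.det ≠ 0)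
    {V : Submodule ℂ (L2 n)} [V.HasOrthogonalProjection] (hV : V ≤ dilate A hA 1 V)
    {Φ : Set (L2 n)} (hΦ : IsNTFGenerator V Φ) {R : ℝ} {J : ℕ}
    (hJ : ∀ j ≥ J, ∀ w : Rn n, ‖w‖ ≤ R → act (A.transpose⁻¹ ^ j) w ∈ unitCube n) {i j : ℕ}
    (hi : J ≤ i) (hij : i ≤ j) :
    ∀ᵐ w ∂(volume.restrict (Metric.closedBall (0 : Rn n) R)),
      spectralSum Φ (act (A.transpose⁻¹ ^ i) w) ≤ spectralSum Φ (act (A.transpose⁻¹ ^ j) w) := by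
  refine ae_le_of_forall_setLIntegral_le_of_sigmaFinite
    ((measurable_spectralSum hΦ.countable).comp (measurable_act _)) fun t ht _ => ?_
  rw [Measure.restrict_restrict ht]
  have hE := ht.inter (Metric.isClosed_closedBall (x := (0 : Rn n)) (ε := R)).measurableSet
  have hv : volume (t ∩ Metric.closedBall (0 : Rn n) R) ≠ ∞ :=
    ne_top_of_le_ne_top measure_closedBall_lt_top.ne (measure_mono Set.inter_subset_right)
  have hQ : ∀ k ≥ J, ∀ w ∈ t ∩ Metric.closedBall (0 : Rn n) R,
      act (A.transpose⁻¹ ^ k) w ∈ unitCube n :=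
    fun k hk w hw => hJ k hk w (mem_closedBall_zero_iff.1 hw.2)
  rw [← enorm_starProjection_bandIndicator_sq hA hΦ i hE hv (hQ i hi),
    ← enorm_starProjection_bandIndicator_sq hA hΦ j hE hv (hQ j (hi.trans hij))]
  gcongr
  rw [enorm_le_iff_norm_le]
  exact norm_starProjection_le_of_le
    (monotone_dilate hA hV (Nat.cast_le.2 hij)) _

theorem ae_spectralSum_le_one {n : ℕ} {A : Matrix (Fin n) (Fin n) ℝ} (hA : A.det ≠ 0)
    {V : Submodule ℂ (L2 n)} [V.HasOrthogonalProjection]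
    {Φ : Set (L2 n)} (hΦ : IsNTFGenerator V Φ) {R : ℝ} {J : ℕ}
    (hJ : ∀ j ≥ J, ∀ w : Rn n, ‖w‖ ≤ R → act (A.transpose⁻¹ ^ j) w ∈ unitCube n) {j : ℕ}
    (hj : J ≤ j) :
    ∀ᵐ w ∂(volume.restrict (Metric.closedBall (0 : Rn n) R)),
      spectralSum Φ (act (A.transpose⁻¹ ^ j) w) ≤ 1 := by
  refine ae_le_of_forall_setLIntegral_le_of_sigmaFinite
    ((measurable_spectralSum hΦ.countable).comp (measurable_act _)) fun t ht _ => ?_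
  rw [Measure.restrict_restrict ht]
  have hE := ht.inter (Metric.isClosed_closedBall (x := (0 : Rn n)) (ε := R)).measurableSet
  have hv : volume (t ∩ Metric.closedBall (0 : Rn n) R) ≠ ∞ :=
    ne_top_of_le_ne_top measure_closedBall_lt_top.ne (measure_mono Set.inter_subset_right)
  have hQ : ∀ w ∈ t ∩ Metric.closedBall (0 : Rn n) R,
      act (A.transpose⁻¹ ^ j) w ∈ unitCube n :=
    fun w hw => hJ j hj w (mem_closedBall_zero_iff.1 hw.2)
  rw [← enorm_starProjection_bandIndicator_sq hA hΦ j hE hv hQ, setLIntegral_one,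
    ← enorm_bandIndicator_sq hE hv]
  gcongr
  rw [enorm_le_iff_norm_le]
  exact Submodule.norm_starProjection_apply_le _ _

theorem tendsto_enorm_sq {H : Type*} [NormedAddCommGroup H] {u : ℕ → H} {x : H}
    (h : Tendsto u atTop (𝓝 x)) : Tendsto (fun j => ‖u j‖ₑ ^ 2) atTop (𝓝 (‖x‖ₑ ^ 2)) :=
  (((ENNReal.continuous_pow 2).comp continuous_enorm).tendsto x).comp h

/-! ### The two implications. -/

theorem ae_tendsto_spectralSum {n : ℕ} {A : Matrix (Fin n) (Fin n) ℝ} (hA : IsDilationMatrix A)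
    {V : Submodule ℂ (L2 n)} [V.HasOrthogonalProjection]
    (hV : V ≤ dilate A hA.det_ne_zero 1 V) {Φ : Set (L2 n)} (hΦ : IsNTFGenerator V Φ)
    (htop : (⨆ j : ℤ, dilate A hA.det_ne_zero j V).topologicalClosure = ⊤) :
    ∀ᵐ w : Rn n,
      Tendsto (fun j : ℕ => spectralSum Φ (act (A.transpose⁻¹ ^ j) w)) atTop (𝓝 1) := by
  have key : ∀ R : ℕ, ∀ᵐ w ∂(volume.restrict (Metric.closedBall (0 : Rn n) R)),
      Tendsto (fun j : ℕ => spectralSum Φ (act (A.transpose⁻¹ ^ j) w)) atTop (𝓝 1) := by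
    intro R
    obtain ⟨J, hJ⟩ := hA.eventually_act_mem_unitCube (R : ℝ)
    set B := Metric.closedBall (0 : Rn n) R with hB
    have hE : MeasurableSet B := Metric.isClosed_closedBall.measurableSet
    have hv : volume B ≠ ∞ := measure_closedBall_lt_top.ne
    have h1 : Tendsto (fun j : ℕ =>
        (dilate A hA.det_ne_zero (j : ℤ) V).starProjection (bandIndicator hE hv)) atTop
        (𝓝 (bandIndicator hE hv)) :=
      (Submodule.starProjection_tendsto_self _ (monotone_dilate hA.det_ne_zero hV) _
        htop.ge).comp tendsto_natCast_atTop_atTop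
    -- The sequence is shifted by `J` because the integral formula holds only once the ball has been
    -- contracted into the cube.
    have h2 := (tendsto_add_atTop_iff_nat J).2 (tendsto_enorm_sq h1)
    have h3 : ∀ j : ℕ, ‖(dilate A hA.det_ne_zero ((j + J : ℕ) : ℤ) V).starProjection
        (bandIndicator hE hv)‖ₑ ^ 2 =
        ∫⁻ w in B, spectralSum Φ (act (A.transpose⁻¹ ^ (j + J)) w) := fun j =>
      enorm_starProjection_bandIndicator_sq hA.det_ne_zero hΦ (j + J) hE hv fun w hw =>
        hJ _ (Nat.le_add_left J j) w (mem_closedBall_zero_iff.1 hw)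
    simp only [h3, enorm_bandIndicator_sq] at h2
    -- An increasing sequence below `1` whose integrals tend to the finite volume of `B` must tend
    -- to `1` a.e. on `B`.
    have h4 := tendsto_of_lintegral_tendsto_of_monotone (μ := volume.restrict B)
      (f := fun j w => spectralSum Φ (act (A.transpose⁻¹ ^ (j + J)) w)) (F := fun _ => 1)
      aemeasurable_const (by simpa using h2)
      (by
        have := ae_all_iff.2 fun j : ℕ => ae_spectralSum_mono hA.det_ne_zero hV hΦ hJ
          (Nat.le_add_left J j) (Nat.add_le_add_right (Nat.le_succ j) J)
        filter_upwards [this] with w hw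
        exact monotone_nat_of_le_succ hw)
      (ae_all_iff.2 fun j => ae_spectralSum_le_one hA.det_ne_zero hΦ hJ (Nat.le_add_left J j))
      (by simpa using hv)
    filter_upwards [h4] with w hw
    exact (tendsto_add_atTop_iff_nat J).1 hw
  have hU : (⋃ R : ℕ, Metric.closedBall (0 : Rn n) R) = Set.univ :=
    Metric.iUnion_closedBall_nat 0
  rw [← Measure.restrict_univ (μ := volume), ← hU, ae_restrict_iUnion_iff]
  exact key

theorem topologicalClosure_iSup_dilate_eq_top {n : ℕ} {A : Matrix (Fin n) (Fin n) ℝ}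
    (hA : IsDilationMatrix A) {V : Submodule ℂ (L2 n)} [V.HasOrthogonalProjection]
    (hV : V ≤ dilate A hA.det_ne_zero 1 V) {Φ : Set (L2 n)} (hΦ : IsNTFGenerator V Φ)
    (hlim : ∀ᵐ w : Rn n,
      Tendsto (fun j : ℕ => spectralSum Φ (act (A.transpose⁻¹ ^ j) w)) atTop (𝓝 1)) :
    (⨆ j : ℤ, dilate A hA.det_ne_zero j V).topologicalClosure = ⊤ := by
  have hm : ∀ j : ℕ, Measurable fun w : Rn n => spectralSum Φ (act (A.transpose⁻¹ ^ j) w) :=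
    fun j => (measurable_spectralSum hΦ.countable).comp (measurable_act _)
  set W := (⨆ j : ℤ, dilate A hA.det_ne_zero j V).topologicalClosure with hW
  have hWc : IsClosed (W : Set (L2 n)) := Submodule.isClosed_topologicalClosure _
  have : CompleteSpace W := hWc.completeSpace_coe
  have key : ∀ E : Set (Rn n), ∀ hE : IsCompact E,
      bandIndicator hE.measurableSet hE.measure_lt_top.ne ∈ W := by
    intro E hE
    set f := bandIndicator hE.measurableSet hE.measure_lt_top.ne with hf
    obtain ⟨R, hR⟩ := hE.isBounded.subset_closedBall (0 : Rn n)
    obtain ⟨J, hJ⟩ := hA.eventually_act_mem_unitCube R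
    -- Without density, the projections of `f` still converge to its projection onto `W`; comparing
    -- norms in the limit then places `f` in `W`.
    have h1 : Tendsto (fun j : ℕ => (dilate A hA.det_ne_zero (j : ℤ) V).starProjection f) atTop
        (𝓝 (W.starProjection f)) :=
      (Submodule.starProjection_tendsto_closure_iSup _ (monotone_dilate hA.det_ne_zero hV)
        f).comp tendsto_natCast_atTop_atTop
    have h2 := (tendsto_add_atTop_iff_nat J).2 (tendsto_enorm_sq h1)
    have h3 : ∀ j : ℕ, ‖(dilate A hA.det_ne_zero ((j + J : ℕ) : ℤ) V).starProjection f‖ₑ ^ 2 =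
        ∫⁻ w in E, spectralSum Φ (act (A.transpose⁻¹ ^ (j + J)) w) := fun j =>
      enorm_starProjection_bandIndicator_sq hA.det_ne_zero hΦ (j + J) _ _ fun w hw =>
        hJ _ (Nat.le_add_left J j) w (mem_closedBall_zero_iff.1 (hR hw))
    simp only [h3] at h2
    have h4 : Tendsto
        (fun j : ℕ => ∫⁻ w in E, spectralSum Φ (act (A.transpose⁻¹ ^ (j + J)) w)) atTop
        (𝓝 (∫⁻ _ in E, 1)) := by
      refine tendsto_lintegral_of_dominated_convergence (fun _ => 1) (fun j => hm _) (fun j => ?_)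
        (by simpa using hE.measure_lt_top.ne) ?_
      · exact ae_restrict_of_ae_restrict_of_subset hR
          (ae_spectralSum_le_one hA.det_ne_zero hΦ hJ (Nat.le_add_left J j))
      · filter_upwards [ae_restrict_of_ae hlim] with w hw
        exact (tendsto_add_atTop_iff_nat J).2 hw
    have h5 := tendsto_nhds_unique h2 h4
    rw [setLIntegral_one, ← enorm_bandIndicator_sq hE.measurableSet hE.measure_lt_top.ne] at h5
    have h6 : ‖W.starProjection f‖ₑ = ‖f‖ₑ := (ENNReal.pow_right_strictMono two_ne_zero).injective h5
    rw [W.mem_iff_norm_starProjection]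
    rw [← ofReal_norm, ← ofReal_norm,
      ENNReal.ofReal_eq_ofReal_iff (norm_nonneg _) (norm_nonneg _)] at h6
    exact h6
  rw [hW, Submodule.topologicalClosure_eq_top_iff, Submodule.eq_bot_iff]
  intro g hg
  rw [← Submodule.orthogonal_closure, ← hW] at hg
  -- Orthogonality of `g` to each `f_E` says that `𝓕 g` has zero integral over every compact set.
  have h7 : (𝓕 g : L2 n) =ᵐ[volume] 0 := by
    refine ae_eq_zero_of_forall_setIntegral_isCompact_eq_zero'
      ((Lp.memLp (𝓕 g : L2 n)).locallyIntegrable (by norm_num)) fun E hE => ?_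
    rw [← inner_bandIndicator hE.measurableSet hE.measure_lt_top.ne]
    exact (Submodule.mem_orthogonal W g).1 hg _ (key E hE)
  rw [← norm_eq_zero, ← Lp.norm_fourier_eq, norm_eq_zero]
  exact (Lp.eq_zero_iff_ae_eq_zero).2 h7

/-! ### Reduction of the statement to subspaces and to the unitary Fourier normalization. -/

/-- Refinability nests the `V_j`, so their union is already a subspace and equals their supremum. -/
theorem closure_iUnion_dilate_eq_univ_iff {n : ℕ} {A : Matrix (Fin n) (Fin n) ℝ}
    (hA : A.det ≠ 0) {V : Submodule ℂ (L2 n)} (hV : V ≤ dilate A hA 1 V) :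
    closure (⋃ j : ℤ, (dilate A hA j V : Set (L2 n))) = Set.univ ↔
      (⨆ j : ℤ, dilate A hA j V).topologicalClosure = ⊤ := by
  rw [← Submodule.coe_iSup_of_directed _ (monotone_dilate hA hV).directed_le,
    ← Submodule.topologicalClosure_coe, ← Submodule.top_coe (R := ℂ), SetLike.coe_set_eq]

theorem ae_comp_smul_iff {n : ℕ} {c : ℝ} (hc : c ≠ 0) {p : Rn n → Prop} :
    (∀ᵐ ξ : Rn n, p (c • ξ)) ↔ ∀ᵐ w : Rn n, p w := by
  have h : ∀ {c : ℝ}, c ≠ 0 →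
      Measure.QuasiMeasurePreserving (fun ξ : Rn n => c • ξ) volume volume := fun {c} hc =>
    ⟨measurable_const_smul c, by
      rw [Measure.map_addHaar_smul _ hc]
      exact Measure.smul_absolutelyContinuous⟩
  refine ⟨fun h1 => ?_, fun h1 => (h hc).ae h1⟩
  have h2 := (h (inv_ne_zero hc)).ae h1
  simpa [smul_smul, hc] using h2

end

end RefinableNTF

theorem proposition3p3 (n : ℕ) (A : Matrix (Fin n) (Fin n) ℝ)
    (hA : RefinableNTF.IsDilationMatrix A)
    (V₀ : Submodule ℂ (RefinableNTF.L2 n)) (hV₀ : RefinableNTF.IsShiftInvariant V₀)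
    (hrefinable : V₀ ≤ RefinableNTF.dilate A hA.det_ne_zero 1 V₀)
    (Φ : Set (RefinableNTF.L2 n)) (hΦ : RefinableNTF.IsNTFGenerator V₀ Φ) :
    closure (⋃ j : ℤ, (RefinableNTF.dilate A hA.det_ne_zero j V₀ : Set (RefinableNTF.L2 n)))
        = Set.univ ↔
      ∀ᵐ ξ : RefinableNTF.Rn n,
        Tendsto (fun j : ℕ => ∑' φ : Φ,
            ‖RefinableNTF.hat (φ : RefinableNTF.L2 n)
              (RefinableNTF.act (((Matrix.transpose A)⁻¹) ^ j) ξ)‖ₑ ^ 2)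
          atTop (𝓝 (1 : ℝ≥0∞)) := by
  have : CompleteSpace V₀ := hV₀.isClosed.completeSpace_coe
  rw [RefinableNTF.closure_iUnion_dilate_eq_univ_iff hA.det_ne_zero hrefinable]
  simp only [RefinableNTF.hat, ← map_smul]
  -- The two Fourier normalizations differ by the scaling `w = ξ / 2π`, which commutes with the
  -- matrix action and preserves null sets in both directions.
  refine Iff.trans ?_ (RefinableNTF.ae_comp_smul_iff (c := (2 * Real.pi)⁻¹) (by positivity)
    (p := fun w => Tendsto (fun j : ℕ => RefinableNTF.spectralSum Φ
      (RefinableNTF.act (A.transpose⁻¹ ^ j) w)) atTop (𝓝 1))).symm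
  exact ⟨RefinableNTF.ae_tendsto_spectralSum hA hrefinable hΦ,
    RefinableNTF.topologicalClosure_iSup_dilate_eq_top hA hrefinable hΦ⟩
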